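/- Let $\Sigma_A,\Sigma_B,\Gamma_A,\Gamma_B$ be finite nonempty sets, let $m\ge 1$ be an integer, let $\mathcal R=\mathbb C^m$, and let $K:\Gamma_A\times\Gamma_B\times\Sigma_A\times\Sigma_B\to \mathrm L(\mathbb C^m)$ be a function with values in the $m\times m$ complex matrices. The following statements are equivalent. 1. $K$ is a commuting measurement assemblage: there are a separable (possibly infinite-dimensional) complex Hilbert space $\mathcal H$, a density operator $\sigma$ on $\mathcal R\otimes\mathcal H$ (a positive semidefinite operator of trace one), and positive semidefinite bounded operators $A^x_a$ and $B^y_b$ on $\mathcal H$ ($x\in\Sigma_A$, $a\in\Gamma_A$, $y\in\Sigma_B$, $b\in\Gamma_B$) with $\sum_{a}A^x_a=\sum_b B^y_b=\mathbb 1_{\mathcal H}$ and $[A^x_a,B^y_b]=0$ for all $x,y,a,b$, such that $$K(a,b|x,y)=\mathrm{tr}_{\mathcal H}\bigl((\mathbb 1_{\mathcal R}\otimes A^x_aB^y_b)\,\sigma\bigr)\qquad\text{for all }a,b,x,y.$$ 2. $K$ is a $k$-th order pseudo commuting measurement assemblage for every positive integer $k$. Here statement 2 is understood as follows. Let $\Delta=(\Sigma_A\times\Gamma_A)\sqcup(\Sigma_B\times\Gamma_B)$,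 let $\Delta^*$ be the set of finite words over $\Delta$, $\Delta^{\le n}$ the set of words of length at most $n$, $\varepsilon$ the empty word, and $s^R$ the reverse of the word $s$. Let $\sim$ be the equivalence relation on $\Delta^*$ generated by $s\sigma t\sim s\sigma\sigma t$ for $s,t\in\Delta^*$, $\sigma\in\Delta$, and $s\sigma\tau t\sim s\tau\sigma t$ for $s,t\in\Delta^*$, $\sigma\in\Sigma_A\times\Gamma_A$, $\tau\in\Sigma_B\times\Gamma_B$. A function $\phi:\Delta^{\le n}\to\mathbb C$ is admissible if the following hold for all words $s,t\in\Delta^*$ for which all arguments of $\phi$ that occur have length at most $n$: - $\sum_{a\in\Gamma_A}\phi(s(x,a)t)=\phi(st)$ and $\sum_{b\in\Gamma_B}\phi(s(y,b)t)=\phi(st)$ for all $x\in\Sigma_A$, $y\in\Sigma_B$; - $\phi(s(x,a)(x,a')t)=0$ whenever $x\in\Sigma_A$ and $a\ne a'$ in $\Gamma_A$, and $\phi(s(y,b)(y,b')t)=0$ whenever $y\in\Sigma_B$ and $b\neq b'$ in $\Gamma_B$; - $\phi(s)=\phi(t)$ whenever $s\sim t$. A $k$-th order admissible matrix is a positive semidefinite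 block matrix $M=(M_{i,j})_{1\le i,j\le m}$ with blocks $M_{i,j}:\Delta^{\le k}\times\Delta^{\le k}\to\mathbb C$ such that $\sum_{i=1}^m M_{i,i}(\varepsilon,\varepsilon)=1$ and such that for all $i,j$ there is an admissible function $\phi_{i,j}:\Delta^{\le 2k}\to\mathbb C$ with $M_{i,j}(s,t)=\phi_{i,j}(s^Rt)$ for all $s,t\in\Delta^{\le k}$. Finally, $K$ is a $k$-th order pseudo commuting measurement assemblage if there is a $k$-th order admissible matrix $M$ with $K(a,b|x,y)=\bigl(M_{i,j}((x,a),(y,b))\bigr)_{i,j=1}^m$ for all $a,b,x,y$. -/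

import Mathlib

open scoped TensorProduct ComplexOrder

noncomputable section

/-! ### Traces, density operators and partial traces -/

/-- The bounded operator `T` on a Hilbert space is trace class with trace `z`: along every
orthonormal basis `(e_n)` the series `∑ ⟨e_n, T e_n⟩` converges unconditionally to `z`. -/
def HasTrace {E : Type} [NormedAddCommGroup E] [InnerProductSpace ℂ E]
    (T : E →L[ℂ] E) (z : ℂ) : Prop :=
  ∀ (ι : Type) (e : HilbertBasis ι ℂ E), HasSum (fun n => inner ℂ (e n) (T (e n))) z

/-- Density operators (quantum states): positive semidefinite operators of trace one. -/
def IsDensityOperator {E : Type} [NormedAddCommGroup E] [InnerProductSpace ℂ E]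
    (ρ : E →L[ℂ] E) : Prop :=
  ρ.IsPositive ∧ HasTrace ρ 1

/-- `T = tr_H(X)` for an operator `X` on `ℂ^m ⊗ H`: the `(i, j)` entry of the `m × m` matrix `T`
is the trace over `H` of the block `(⟨e_i| ⊗ 1) X (|e_j⟩ ⊗ 1)` of `X`, where `e_1, …, e_m` is the
standard basis of `ℂ^m`. As `ℂ^m` is finite-dimensional, the algebraic tensor product with its
inner product is already the Hilbert space tensor product. -/
def HasPartialTrace {m : ℕ} {H : Type} [NormedAddCommGroup H] [InnerProductSpace ℂ H]
    (X : (EuclideanSpace ℂ (Fin m) ⊗[ℂ] H) →ₗ[ℂ] (EuclideanSpace ℂ (Fin m) ⊗[ℂ] H))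
    (T : Matrix (Fin m) (Fin m) ℂ) : Prop :=
  ∀ (ι : Type) (f : HilbertBasis ι ℂ H) (i j : Fin m),
    HasSum
      (fun n => inner ℂ ((EuclideanSpace.single i (1 : ℂ)) ⊗ₜ[ℂ] (f n))
        (X ((EuclideanSpace.single j (1 : ℂ)) ⊗ₜ[ℂ] (f n))))
      (T i j)

/-! ### Commuting measurement strategies and assemblages -/

/-- A commuting measurement strategy on the Hilbert space `H`, with question sets `SA`, `SB`,
answer sets `GA`, `GB`, and referee space `ℂ^m`. -/
structure CommutingMeasurementStrategy (SA SB GA GB : Type*) [Fintype GA] [Fintype GB] (m : ℕ)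
    (H : Type) [NormedAddCommGroup H] [InnerProductSpace ℂ H] where
  /-- the shared state of the referee and the players -/
  state : (EuclideanSpace ℂ (Fin m) ⊗[ℂ] H) →L[ℂ] (EuclideanSpace ℂ (Fin m) ⊗[ℂ] H)
  /-- the measurement operators of Alice -/
  A : SA → GA → (H →L[ℂ] H)
  /-- the measurement operators of Bob -/
  B : SB → GB → (H →L[ℂ] H)
  state_density : IsDensityOperator state
  A_pos : ∀ x a, (A x a).IsPositive
  B_pos : ∀ y b, (B y b).IsPositive
  A_sum : ∀ x, ∑ a, A x a = 1
  B_sum : ∀ y, ∑ b, B y b = 1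
  comm : ∀ x a y b, Commute (A x a) (B y b)

/-- `K` is a commuting measurement assemblage: `K(a,b|x,y) = tr_H((1 ⊗ A^x_a B^y_b) σ)` for some
commuting measurement strategy on a (separable, possibly infinite-dimensional) Hilbert space. -/
def IsCommutingMeasurementAssemblage {SA SB GA GB : Type*} [Fintype GA] [Fintype GB] {m : ℕ}
    (K : GA → GB → SA → SB → Matrix (Fin m) (Fin m) ℂ) : Prop :=
  ∃ (H : Type) (_ : NormedAddCommGroup H) (_ : InnerProductSpace ℂ H) (_ : CompleteSpace H)
    (_ : TopologicalSpace.SeparableSpace H)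
    (S : CommutingMeasurementStrategy SA SB GA GB m H),
    ∀ a b x y,
      HasPartialTrace
        (LinearMap.lTensor (EuclideanSpace ℂ (Fin m)) (S.A x a * S.B y b).toLinearMap ∘ₗ
          S.state.toLinearMap)
        (K a b x y)

/-! ### Words and admissible functions -/

/-- The alphabet `Δ = (SA × GA) ⊔ (SB × GB)`. -/
abbrev Letter (SA SB GA GB : Type*) := (SA × GA) ⊕ (SB × GB)

/-- The set `Δ^{≤ n}` of words of length at most `n` over `Δ`. -/
abbrev WordLE (SA SB GA GB : Type*) (n : ℕ) :=
  {w : List (Letter SA SB GA GB) // w.length ≤ n}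

/-- The two rewriting rules generating the equivalence of words. -/
inductive WordRule {SA SB GA GB : Type*} :
    List (Letter SA SB GA GB) → List (Letter SA SB GA GB) → Prop
  | double (s t : List (Letter SA SB GA GB)) (σ : Letter SA SB GA GB) :
      WordRule (s ++ [σ] ++ t) (s ++ [σ, σ] ++ t)
  | swap (s t : List (Letter SA SB GA GB)) (σ : SA × GA) (τ : SB × GB) :
      WordRule (s ++ [Sum.inl σ, Sum.inr τ] ++ t) (s ++ [Sum.inr τ, Sum.inl σ] ++ t)

/-- The equivalence relation on `Δ^*` generated by the rewriting rules. -/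
def WordEquiv {SA SB GA GB : Type*} (s t : List (Letter SA SB GA GB)) : Prop :=
  Relation.EqvGen WordRule s t

/-- Admissibility of a function `φ : Δ^{≤ n} → ℂ`. Each condition is imposed on all words for
which the arguments of `φ` that occur in it have length at most `n`. -/
structure IsAdmissibleFunction {SA SB GA GB : Type*} [Fintype GA] [Fintype GB] {n : ℕ}
    (φ : WordLE SA SB GA GB n → ℂ) : Prop where
  sum_left : ∀ (s t : List (Letter SA SB GA GB)) (h : s.length + 1 + t.length ≤ n) (x : SA),
    ∑ a : GA, φ ⟨s ++ [Sum.inl (x, a)] ++ t, by simp; omega⟩ = φ ⟨s ++ t, by simp; omega⟩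
  sum_right : ∀ (s t : List (Letter SA SB GA GB)) (h : s.length + 1 + t.length ≤ n) (y : SB),
    ∑ b : GB, φ ⟨s ++ [Sum.inr (y, b)] ++ t, by simp; omega⟩ = φ ⟨s ++ t, by simp; omega⟩
  orth_left : ∀ (s t : List (Letter SA SB GA GB)) (h : s.length + 2 + t.length ≤ n) (x : SA)
    (a a' : GA), a ≠ a' →
    φ ⟨s ++ [Sum.inl (x, a), Sum.inl (x, a')] ++ t, by simp; omega⟩ = 0
  orth_right : ∀ (s t : List (Letter SA SB GA GB)) (h : s.length + 2 + t.length ≤ n) (y : SB)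
    (b b' : GB), b ≠ b' →
    φ ⟨s ++ [Sum.inr (y, b), Sum.inr (y, b')] ++ t, by simp; omega⟩ = 0
  congr : ∀ s t : WordLE SA SB GA GB n, WordEquiv s.1 t.1 → φ s = φ t

/-! ### Admissible block matrices and pseudo commuting measurement assemblages -/

/-- The `m × m` matrix `M(s,t)` of a block matrix `M`. -/
def momentEntry {W : Type*} {m : ℕ} (M : Matrix (Fin m × W) (Fin m × W) ℂ) (s t : W) :
    Matrix (Fin m) (Fin m) ℂ :=
  Matrix.of fun i j => M (i, s) (j, t)

/-- `k`-th order admissible matrices, with blocks `M_{i,j} : Δ^{≤ k} × Δ^{≤ k} → ℂ`. -/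
structure IsAdmissibleMatrix {SA SB GA GB : Type*} [Fintype GA] [Fintype GB] {m k : ℕ}
    (M : Matrix (Fin m × WordLE SA SB GA GB k) (Fin m × WordLE SA SB GA GB k) ℂ) : Prop where
  admissible : ∀ i j : Fin m, ∃ φ : WordLE SA SB GA GB (2 * k) → ℂ,
    IsAdmissibleFunction φ ∧
      ∀ s t : WordLE SA SB GA GB k,
        M (i, s) (j, t) =
          φ ⟨s.1.reverse ++ t.1, by have := s.2; have := t.2; simp; omega⟩
  normalized : ∑ i : Fin m, M (i, ⟨[], Nat.zero_le k⟩) (i, ⟨[], Nat.zero_le k⟩) = 1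
  posSemidef : M.PosSemidef

/-- `k`-th order pseudo commuting measurement assemblages, for positive `k`: there is a `k`-th
order admissible matrix `M` with `K(a,b|x,y) = M((x,a),(y,b))`. -/
def IsPseudoCommutingMeasurementAssemblage {SA SB GA GB : Type*} [Fintype GA] [Fintype GB] {m : ℕ}
    (k : ℕ) (hk : 1 ≤ k) (K : GA → GB → SA → SB → Matrix (Fin m) (Fin m) ℂ) : Prop :=
  ∃ M : Matrix (Fin m × WordLE SA SB GA GB k) (Fin m × WordLE SA SB GA GB k) ℂ,
    IsAdmissibleMatrix M ∧
      ∀ a b x y, K a b x y = momentEntry M ⟨[Sum.inl (x, a)], hk⟩ ⟨[Sum.inr (y, b)], hk⟩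

end

noncomputable section

open Filter Topology
open scoped InnerProductSpace

-- Positive semidefinite matrices and Gram vectors

universe u

/-! Moments of words correspond to products of projections: φ_{i,j}(w) = ⟨ψ_j, P_{w^R} ψ_i⟩, where
the projections P of the two players commute. For the pure state on ∑ e_i ⊗ ψ_i the (i, j) entry of
the partial trace is ⟨ψ_j, X ψ_i⟩; this exchange of i and j is the source of the transposes and
reversed words below.

From 2 to 1: entries of an admissible matrix of any order have modulus at most one
(`IsAdmissibleMatrix.norm_apply_le_one`), so along one ultrafilter all moments converge to
functionals on all words (`exists_isMomentFunctional`). A GNS construction follows: the limit is a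
Gram matrix of vectors v(i, s), prepending a letter is the action of an orthogonal projection
(`letterProjection_apply`), and the moment relations become operator identities. The vectors of the
empty word give a pure state.

From 1 to 2: the given measurements need not be projective and the state may be mixed. Naimark
dilation, carried out with finite matrices over the operator algebra, once for each player, yields
commuting projective measurements (`exists_isLetterRepresentation`). The density operator is a sum
of |ψ_k⟩⟨ψ_k| (`IsDensityOperator.exists_vectors`), so the moments are ∑_k ⟨ψ_{k,j}, X ψ_{k,i}⟩ with
X the corner entry of the dilated word. They form a limit of sums of Gram matrices, hence a positive
semidefinite matrix. -/

/-- Reproducing kernels are operator-valued, so each scalar entry is read as a multiplication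
operator on ℂ. -/
theorem Matrix.PosSemidef.map_algebraMap_clm {X : Type*} {M : Matrix X X ℂ} (hM : M.PosSemidef) :
    (M.map fun z => z • (1 : ℂ →L[ℂ] ℂ)).PosSemidef := by
  have h02 := (RKHS.posSemidef_tfae (K := M.map fun z => z • (1 : ℂ →L[ℂ] ℂ))).out 0 2
  refine h02.mpr ⟨?_, fun f => ?_⟩
  · ext x y
    simp only [Matrix.conjTranspose_apply, Matrix.map_apply, star_smul, star_one]
    rw [← hM.1.apply x y]
  · have h := (Complex.le_def.mp (hM.2 f)).1
    simp only [Complex.zero_re] at h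
    refine h.trans_eq ?_
    simp only [RCLike.re_to_complex]
    congr 1
    refine Finsupp.sum_congr fun x _ => Finsupp.sum_congr fun y _ => ?_
    simp only [Matrix.map_apply, FunLike.coe_smul, Pi.smul_apply, one_apply_eq_self,
      smul_eq_mul, RCLike.inner_apply, map_mul, ← hM.1.apply x y, RCLike.star_def]
    ring

/-- A positive semidefinite matrix is the Gram matrix of a total family in a Hilbert space. -/
theorem Matrix.PosSemidef.exists_gram {X : Type u} {M : Matrix X X ℂ} (hM : M.PosSemidef) :
    ∃ (H : Type u) (_ : NormedAddCommGroup H) (_ : InnerProductSpace ℂ H) (_ : CompleteSpace H)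
      (v : X → H), (∀ x y, ⟪v x, v y⟫_ℂ = M x y) ∧
        (Submodule.span ℂ (Set.range v)).topologicalClosure = ⊤ := by
  have : Fact (M.map fun z => z • (1 : ℂ →L[ℂ] ℂ)).PosSemidef := ⟨hM.map_algebraMap_clm⟩
  let K := M.map fun z => z • (1 : ℂ →L[ℂ] ℂ)
  refine ⟨RKHS.OfKernel K, inferInstance, inferInstance, inferInstance,
    fun x => RKHS.kerFun (RKHS.OfKernel K) x 1, fun x y => ?_, ?_⟩
  · rw [RKHS.kerFun_inner, RKHS.kerFun_apply, RKHS.OfKernel.kernel_ofKernel]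
    simp [K]
  · rw [eq_top_iff, ← RKHS.kerFun_dense (RKHS.OfKernel K)]
    refine Submodule.topologicalClosure_mono (Submodule.span_le.mpr ?_)
    rintro _ ⟨x, z, rfl⟩
    have : RKHS.kerFun (RKHS.OfKernel K) x z = z • RKHS.kerFun (RKHS.OfKernel K) x 1 := by
      rw [← map_smul, smul_eq_mul, mul_one]
    rw [this]
    exact Submodule.smul_mem _ _ (Submodule.subset_span ⟨x, rfl⟩)

theorem Matrix.PosSemidef.norm_apply_sq_le {X : Type*} {M : Matrix X X ℂ} (hM : M.PosSemidef)
    (x y : X) : ‖M x y‖ ^ 2 ≤ ‖M x x‖ * ‖M y y‖ := by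
  obtain ⟨H, _, _, _, v, hv, -⟩ := hM.exists_gram
  rw [← hv, ← hv x x, ← hv y y, inner_self_eq_norm_sq_to_K, inner_self_eq_norm_sq_to_K]
  simp only [norm_pow, RCLike.norm_ofReal, abs_norm]
  have := norm_inner_le_norm (𝕜 := ℂ) (v x) (v y)
  nlinarith [norm_nonneg (⟪v x, v y⟫_ℂ)]

theorem separableSpace_of_dense_span {X : Type*} [Countable X] {H : Type*} [NormedAddCommGroup H]
    [InnerProductSpace ℂ H] (v : X → H)
    (hd : (Submodule.span ℂ (Set.range v)).topologicalClosure = ⊤) :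
    TopologicalSpace.SeparableSpace H := by
  have h : TopologicalSpace.IsSeparable (Set.range v) := (Set.countable_range v).isSeparable
  have h2 := (h.span (R := ℂ)).closure
  rw [← Submodule.topologicalClosure_coe, hd, Submodule.top_coe] at h2
  exact TopologicalSpace.isSeparable_univ_iff.mp h2

theorem ContinuousLinearMap.ext_of_dense_span {X H : Type*} [NormedAddCommGroup H]
    [InnerProductSpace ℂ H] {v : X → H}
    (hd : (Submodule.span ℂ (Set.range v)).topologicalClosure = ⊤) {S T : H →L[ℂ] H}
    (h : ∀ x, S (v x) = T (v x)) : S = T := by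
  refine ContinuousLinearMap.ext_on (s := Set.range v) ?_ ?_
  · rw [dense_iff_closure_eq, ← Submodule.topologicalClosure_coe, hd, Submodule.top_coe]
  · rintro _ ⟨x, rfl⟩
    exact h x

theorem eq_of_inner_dense_span {X H : Type*} [NormedAddCommGroup H]
    [InnerProductSpace ℂ H] {v : X → H}
    (hd : (Submodule.span ℂ (Set.range v)).topologicalClosure = ⊤) {a b : H}
    (h : ∀ x, ⟪a, v x⟫_ℂ = ⟪b, v x⟫_ℂ) : a = b := by
  have : innerSL ℂ a = innerSL ℂ b := by
    refine ContinuousLinearMap.ext_on (s := Set.range v) ?_ ?_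
    · rw [dense_iff_closure_eq, ← Submodule.topologicalClosure_coe, hd, Submodule.top_coe]
    · rintro _ ⟨x, rfl⟩
      exact h x
  exact ext_inner_right ℂ fun x => congrArg (fun f => f x) this

/-- The orthogonal projection onto the closed span of a family of vectors. -/
def spanProjection {X H : Type*} [NormedAddCommGroup H] [InnerProductSpace ℂ H] [CompleteSpace H]
    (w : X → H) : H →L[ℂ] H :=
  (Submodule.span ℂ (Set.range w)).topologicalClosure.starProjection

section spanProjection

variable {X H : Type*} [NormedAddCommGroup H] [InnerProductSpace ℂ H] [CompleteSpace H]

theorem isPositive_spanProjection (w : X → H) : (spanProjection w).IsPositive :=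
  ContinuousLinearMap.IsPositive.of_isStarProjection
    (isStarProjection_starProjection (U := (Submodule.span ℂ (Set.range w)).topologicalClosure))

/-- The difference v(s) - v(g s) is orthogonal to every v(g t), because g is symmetric and
idempotent for the inner products. Using the projection onto a closed span makes boundedness and
well-definedness automatic. -/
theorem spanProjection_apply {v : X → H} {g : X → X}
    (hs : ∀ s t, ⟪v (g s), v t⟫_ℂ = ⟪v s, v (g t)⟫_ℂ)
    (hi : ∀ s t, ⟪v (g (g s)), v t⟫_ℂ = ⟪v (g s), v t⟫_ℂ) (s : X) :
    spanProjection (v ∘ g) (v s) = v (g s) := by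
  refine Submodule.eq_starProjection_of_mem_orthogonal
    (K := (Submodule.span ℂ (Set.range (v ∘ g))).topologicalClosure) ?_ ?_
  · exact Submodule.le_topologicalClosure _ (Submodule.subset_span ⟨s, rfl⟩)
  · rw [Submodule.orthogonal_closure]
    rw [Submodule.mem_orthogonal]
    intro u hu
    induction hu using Submodule.span_induction with
    | mem x hx =>
      obtain ⟨t, rfl⟩ := hx
      simp only [Function.comp_apply, inner_sub_right]
      rw [← hs (g t) s, hi, sub_self]
    | zero => simp
    | add x y _ _ hx hy => rw [inner_add_left, hx, hy, add_zero]
    | smul c x _ hx => rw [inner_smul_left, hx, mul_zero]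

end spanProjection

/-- Positivity is tested on finitely supported vectors, so entrywise convergence suffices. -/
theorem Matrix.PosSemidef.of_tendsto {X ι : Type*} {l : Filter ι} [l.NeBot]
    {N : ι → Matrix X X ℂ} {M : Matrix X X ℂ} (hN : ∀ k, (N k).PosSemidef)
    (h : ∀ x y, Tendsto (fun k => N k x y) l (𝓝 (M x y))) : M.PosSemidef := by
  refine ⟨?_, fun f => ?_⟩
  · ext x y
    rw [Matrix.conjTranspose_apply]
    refine tendsto_nhds_unique (((continuous_star.tendsto _).comp (h y x))) ((h x y).congr ?_)
    intro k
    exact ((hN k).1.apply x y).symm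
  · refine ge_of_tendsto (x := l) (tendsto_finsetSum _ fun x _ => tendsto_finsetSum _ fun y _ =>
      ((h x y).const_mul (star (f x))).mul_const (f y)) (Eventually.of_forall fun k => (hN k).2 f)

theorem Matrix.posSemidef_of_inner {X : Type*} {H : Type*} [NormedAddCommGroup H]
    [InnerProductSpace ℂ H] {M : Matrix X X ℂ} (v : X → H) (h : ∀ x y, M x y = ⟪v x, v y⟫_ℂ) :
    M.PosSemidef := by
  refine ⟨?_, fun f => ?_⟩
  · ext x y
    rw [Matrix.conjTranspose_apply, h, h]
    exact inner_conj_symm _ _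
  · have : (f.sum fun x a => f.sum fun y b => star a * M x y * b) =
        ⟪f.sum fun x a => a • v x, f.sum fun x a => a • v x⟫_ℂ := by
      simp only [Finsupp.sum]
      rw [sum_inner]
      simp_rw [inner_sum, inner_smul_left, inner_smul_right, h]
      refine Finset.sum_congr rfl fun x _ => Finset.sum_congr rfl fun y _ => ?_
      rw [RCLike.star_def]
      ring
    rw [this, inner_self_eq_norm_sq_to_K]
    exact pow_nonneg (Complex.zero_le_real.2 (norm_nonneg (f.sum fun x a => a • v x))) 2

/-! ### Uniform bounds and the limit of admissible matrices -/

/-- Extension of a function of short words by zero to all words. -/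
def extendWord {SA SB GA GB : Type*} {n : ℕ} (φ : WordLE SA SB GA GB n → ℂ)
    (w : List (Letter SA SB GA GB)) : ℂ :=
  if h : w.length ≤ n then φ ⟨w, h⟩ else 0

/-- The extension by zero of a matrix indexed by short words. -/
def extendMatrix {SA SB GA GB : Type*} {m k : ℕ}
    (M : Matrix (Fin m × WordLE SA SB GA GB k) (Fin m × WordLE SA SB GA GB k) ℂ) :
    Matrix (Fin m × List (Letter SA SB GA GB)) (Fin m × List (Letter SA SB GA GB)) ℂ :=
  Matrix.of fun p q => if h : p.2.length ≤ k ∧ q.2.length ≤ k then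
    M (p.1, ⟨p.2, h.1⟩) (q.1, ⟨q.2, h.2⟩) else 0

/-- Long words receive the Gram vector 0. This puts the matrices of all orders on one index set,
where limits can be taken. -/
theorem Matrix.PosSemidef.extendMatrix {SA SB GA GB : Type*} {m k : ℕ}
    {M : Matrix (Fin m × WordLE SA SB GA GB k) (Fin m × WordLE SA SB GA GB k) ℂ}
    (hM : M.PosSemidef) : (extendMatrix M).PosSemidef := by
  obtain ⟨H, _, _, _, v, hv, -⟩ := hM.exists_gram
  refine Matrix.posSemidef_of_inner
    (fun p => if h : p.2.length ≤ k then v (p.1, ⟨p.2, h⟩) else 0) fun p q => ?_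
  by_cases hp : p.2.length ≤ k <;> by_cases hq : q.2.length ≤ k <;>
    simp [_root_.extendMatrix, hp, hq, hv]

section IsAdmissibleMatrix

variable {SA SB GA GB : Type*} [Fintype GA] [Fintype GB] {m k : ℕ}
  {M : Matrix (Fin m × WordLE SA SB GA GB k) (Fin m × WordLE SA SB GA GB k) ℂ}

/-- By the doubling rule the entry at σs is φ(s^R σ s). Summed over the answers to the question of
σ, these nonnegative numbers give the entry at s, so diagonal entries decrease as words grow. -/
theorem IsAdmissibleMatrix.diag_le_one (hM : IsAdmissibleMatrix M) (i : Fin m) :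
    ∀ (s : List (Letter SA SB GA GB)) (hs : s.length ≤ k), M (i, ⟨s, hs⟩) (i, ⟨s, hs⟩) ≤ 1
  | [], hs => by
    rw [← hM.normalized]
    exact Finset.single_le_sum (f := fun i => M (i, ⟨[], hs⟩) (i, ⟨[], hs⟩))
      (fun j _ => hM.posSemidef.diag_nonneg) (Finset.mem_univ i)
  | σ :: s, hs => by
    have hs' : s.length + 1 ≤ k := by simpa using hs
    obtain ⟨φ, hφ, hMφ⟩ := hM.admissible i i
    refine le_trans ?_ (IsAdmissibleMatrix.diag_le_one hM i s (by omega))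
    have key : ∀ τ : Letter SA SB GA GB, M (i, ⟨τ :: s, hs⟩) (i, ⟨τ :: s, hs⟩) =
        φ ⟨s.reverse ++ [τ] ++ s, by simp; omega⟩ := by
      intro τ
      rw [hMφ]
      refine hφ.congr _ _ (.symm _ _ ?_)
      have := Relation.EqvGen.rel _ _ (WordRule.double s.reverse s τ)
      simpa [WordEquiv] using this
    have hnil : M (i, ⟨s, by omega⟩) (i, ⟨s, by omega⟩) =
        φ ⟨s.reverse ++ s, by simp; omega⟩ := hMφ _ _
    rcases σ with ⟨x, a⟩ | ⟨y, b⟩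
    · rw [hnil, ← hφ.sum_left s.reverse s (by simp; omega) x]
      simp_rw [← key]
      exact Finset.single_le_sum (f := fun a => M (i, ⟨Sum.inl (x, a) :: s, hs⟩)
        (i, ⟨Sum.inl (x, a) :: s, hs⟩)) (fun j _ => hM.posSemidef.diag_nonneg) (Finset.mem_univ a)
    · rw [hnil, ← hφ.sum_right s.reverse s (by simp; omega) y]
      simp_rw [← key]
      exact Finset.single_le_sum (f := fun b => M (i, ⟨Sum.inr (y, b) :: s, hs⟩)
        (i, ⟨Sum.inr (y, b) :: s, hs⟩)) (fun j _ => hM.posSemidef.diag_nonneg) (Finset.mem_univ b)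

theorem IsAdmissibleMatrix.norm_apply_le_one (hM : IsAdmissibleMatrix M)
    (p q : Fin m × WordLE SA SB GA GB k) : ‖M p q‖ ≤ 1 := by
  have hd : ∀ p, ‖M p p‖ ≤ 1 := fun p => by
    have h := Complex.le_def.mp (hM.diag_le_one p.1 p.2.1 p.2.2)
    have h0 : 0 ≤ M p p := hM.posSemidef.diag_nonneg
    rw [← Complex.re_eq_norm.2 h0]
    exact h.1
  have := hM.posSemidef.norm_apply_sq_le p q
  have h1 : ‖M p p‖ * ‖M q q‖ ≤ 1 := mul_le_one₀ (hd p) (norm_nonneg _) (hd q)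
  exact (sq_le_one_iff₀ (norm_nonneg _)).mp (this.trans h1)

theorem IsAdmissibleMatrix.norm_extendWord_le_one (hM : IsAdmissibleMatrix M) {i j : Fin m}
    {φ : WordLE SA SB GA GB (2 * k) → ℂ}
    (hφ : ∀ s t : WordLE SA SB GA GB k, M (i, s) (j, t) =
      φ ⟨s.1.reverse ++ t.1, by have := s.2; have := t.2; simp; omega⟩)
    (w : List (Letter SA SB GA GB)) : ‖extendWord φ w‖ ≤ 1 := by
  unfold extendWord
  split_ifs with h
  · have h1 : (w.take k).reverse.length ≤ k := by simp
    -- A word of length at most 2k splits into two words of length at most k, so its moment is an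
    -- entry of M.
    have h2 : (w.drop k).length ≤ k := by simp; omega
    have := hφ ⟨(w.take k).reverse, h1⟩ ⟨w.drop k, h2⟩
    simp only [List.reverse_reverse, List.take_append_drop] at this
    rw [← this]
    exact hM.norm_apply_le_one _ _
  · simp

end IsAdmissibleMatrix

/-- A matrix of functionals on words satisfying the admissibility conditions for all words. -/
structure IsMomentFunctional {SA SB GA GB : Type*} [Fintype GA] [Fintype GB] {m : ℕ}
    (φ : Fin m → Fin m → List (Letter SA SB GA GB) → ℂ) : Prop where
  sum_left : ∀ i j s t x, ∑ a : GA, φ i j (s ++ [Sum.inl (x, a)] ++ t) = φ i j (s ++ t)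
  sum_right : ∀ i j s t y, ∑ b : GB, φ i j (s ++ [Sum.inr (y, b)] ++ t) = φ i j (s ++ t)
  congr : ∀ i j s t, WordEquiv s t → φ i j s = φ i j t
  normalized : ∑ i, φ i i [] = 1
  posSemidef : (Matrix.of fun p q : Fin m × List (Letter SA SB GA GB) =>
    φ p.1 q.1 (p.2.reverse ++ q.2)).PosSemidef

/-- A fixed ultrafilter works for all words at once, so no diagonal subsequence is needed. -/
theorem exists_tendsto_hyperfilter {f : ℕ → ℂ} (hf : ∀ k, ‖f k‖ ≤ 1) :
    ∃ z, Tendsto f (hyperfilter ℕ) (𝓝 z) := by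
  obtain ⟨z, -, hz⟩ := (isCompact_closedBall (0 : ℂ) 1).ultrafilter_le_nhds
    ((hyperfilter ℕ).map f) (by
      simp only [Ultrafilter.coe_map, le_principal_iff, mem_map]
      exact Eventually.of_forall fun k => by simpa using hf k)
  exact ⟨z, hz⟩

theorem exists_isMomentFunctional {SA SB GA GB : Type*} [Fintype GA] [Fintype GB] {m : ℕ}
    {K : GA → GB → SA → SB → Matrix (Fin m) (Fin m) ℂ}
    (hK : ∀ (k : ℕ) (hk : 1 ≤ k), IsPseudoCommutingMeasurementAssemblage k hk K) :
    ∃ φ : Fin m → Fin m → List (Letter SA SB GA GB) → ℂ, IsMomentFunctional φ ∧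
      ∀ a b x y i j, K a b x y i j = φ i j [Sum.inl (x, a), Sum.inr (y, b)] := by
  choose M hM hKM using fun k : ℕ => hK (k + 1) (Nat.le_add_left 1 k)
  choose φ hφ hMφ using fun k => (hM k).admissible
  choose g hg using fun i j w => exists_tendsto_hyperfilter
    (f := fun k => extendWord (φ k i j) w)
    (fun k => (hM k).norm_extendWord_le_one (hMφ k i j) w)
  -- Each relation involves finitely many words, so for large k none of them falls under the default
  -- value 0.
  have hev : ∀ n : ℕ, ∀ᶠ k in (hyperfilter ℕ : Filter ℕ), n ≤ k := fun n =>
    (Nat.hyperfilter_le_atTop) (eventually_ge_atTop n)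
  have hcongr : ∀ i j i' j' s t, (∀ᶠ k in (hyperfilter ℕ : Filter ℕ),
      extendWord (φ k i j) s = extendWord (φ k i' j') t) → g i j s = g i' j' t :=
    fun i j i' j' s t h => tendsto_nhds_unique (hg i j s) ((hg i' j' t).congr' (h.mono
      fun k hk => hk.symm))
  have hM0 : ∀ k i j (s t : List (Letter SA SB GA GB)) (hs : s.length ≤ k + 1)
      (ht : t.length ≤ k + 1), M k (i, ⟨s, hs⟩) (j, ⟨t, ht⟩) =
        extendWord (φ k i j) (s.reverse ++ t) := by
    intro k i j s t hs ht
    rw [hMφ, extendWord, dif_pos]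
  refine ⟨g, ⟨?_, ?_, ?_, ?_, ?_⟩, ?_⟩
  · intro i j s t x
    refine tendsto_nhds_unique (tendsto_finsetSum _ fun a _ => hg i j _)
      ((hg i j (s ++ t)).congr' ?_)
    filter_upwards [hev (s.length + 1 + t.length)] with k hk
    have := (hφ k i j).sum_left s t (by omega) x
    rw [extendWord, dif_pos (by simp; omega), ← this]
    refine Finset.sum_congr rfl fun a _ => ?_
    rw [extendWord, dif_pos]
  · intro i j s t x
    refine tendsto_nhds_unique (tendsto_finsetSum _ fun a _ => hg i j _)
      ((hg i j (s ++ t)).congr' ?_)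
    filter_upwards [hev (s.length + 1 + t.length)] with k hk
    have := (hφ k i j).sum_right s t (by omega) x
    rw [extendWord, dif_pos (by simp; omega), ← this]
    refine Finset.sum_congr rfl fun a _ => ?_
    rw [extendWord, dif_pos]
  · intro i j s t hst
    refine hcongr i j i j s t ?_
    filter_upwards [hev s.length, hev t.length] with k hs ht
    rw [extendWord, dif_pos (by omega), extendWord, dif_pos (by omega)]
    exact (hφ k i j).congr _ _ hst
  · refine tendsto_nhds_unique (tendsto_finsetSum _ fun i _ => hg i i [])
      (tendsto_const_nhds.congr fun k => ?_)
    rw [← (hM k).normalized]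
    refine Finset.sum_congr rfl fun i _ => ?_
    rw [hM0]
    rfl
  · refine Matrix.PosSemidef.of_tendsto (fun k => (hM k).posSemidef.extendMatrix)
      (l := hyperfilter ℕ) fun p q => (hg p.1 q.1 _).congr' ?_
    filter_upwards [hev p.2.length, hev q.2.length] with k hp hq
    rw [extendMatrix, Matrix.of_apply, dif_pos ⟨by omega, by omega⟩, hM0]
  · intro a b x y i j
    refine tendsto_nhds_unique (tendsto_const_nhds.congr fun k => ?_) (hg i j _)
    rw [hKM k a b x y, momentEntry, Matrix.of_apply, hM0]
    rfl

/-! ### Vectors of ℂ^m ⊗ H and pure states -/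

theorem isDensityOperator_rankOne {E : Type} [NormedAddCommGroup E] [InnerProductSpace ℂ E]
    {ψ : E} (hψ : ⟪ψ, ψ⟫_ℂ = 1) : IsDensityOperator (InnerProductSpace.rankOne ℂ ψ ψ) := by
  refine ⟨InnerProductSpace.isPositive_rankOne_self ψ, fun ι e => ?_⟩
  have := e.hasSum_inner_mul_inner ψ ψ
  rw [hψ] at this
  refine this.congr_fun fun n => ?_
  rw [InnerProductSpace.rankOne_apply, inner_smul_right]

/-- The vector `∑ i, e_i ⊗ ψ_i` of `ℂ^m ⊗ H`. -/
def sumTensor {m : ℕ} {H : Type*} [NormedAddCommGroup H] [InnerProductSpace ℂ H]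
    (ψ : Fin m → H) : EuclideanSpace ℂ (Fin m) ⊗[ℂ] H :=
  ∑ i, EuclideanSpace.single i (1 : ℂ) ⊗ₜ[ℂ] ψ i

section sumTensor

variable {m : ℕ} {H : Type*} [NormedAddCommGroup H] [InnerProductSpace ℂ H]

theorem inner_single_tmul_sumTensor (ψ : Fin m → H) (i : Fin m) (h : H) :
    ⟪EuclideanSpace.single i (1 : ℂ) ⊗ₜ[ℂ] h, sumTensor ψ⟫_ℂ = ⟪h, ψ i⟫_ℂ := by
  rw [sumTensor, inner_sum, Finset.sum_eq_single i]
  · simp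
  · intro j _ hj
    simp [EuclideanSpace.inner_single_left, Ne.symm hj]
  · simp

theorem inner_sumTensor_single_tmul (ψ : Fin m → H) (i : Fin m) (h : H) :
    ⟪sumTensor ψ, EuclideanSpace.single i (1 : ℂ) ⊗ₜ[ℂ] h⟫_ℂ = ⟪ψ i, h⟫_ℂ := by
  rw [← inner_conj_symm (sumTensor ψ), inner_single_tmul_sumTensor, inner_conj_symm]

theorem inner_sumTensor (ψ χ : Fin m → H) :
    ⟪sumTensor ψ, sumTensor χ⟫_ℂ = ∑ i, ⟪ψ i, χ i⟫_ℂ := by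
  conv_lhs => rw [sumTensor, sum_inner]
  simp_rw [inner_single_tmul_sumTensor]

theorem lTensor_sumTensor (X : H →ₗ[ℂ] H) (ψ : Fin m → H) :
    X.lTensor (EuclideanSpace ℂ (Fin m)) (sumTensor ψ) = sumTensor fun i => X (ψ i) := by
  simp [sumTensor]

end sumTensor

/-- Parseval's identity, with the bra of the rank one state supplying ψ_j and the ket ψ_i. -/
theorem hasPartialTrace_rankOne {m : ℕ} {H : Type} [NormedAddCommGroup H] [InnerProductSpace ℂ H]
    (X : H →ₗ[ℂ] H) (ψ : Fin m → H) {T : Matrix (Fin m) (Fin m) ℂ}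
    (hT : ∀ i j, T i j = ⟪ψ j, X (ψ i)⟫_ℂ) :
    HasPartialTrace (X.lTensor (EuclideanSpace ℂ (Fin m)) ∘ₗ
      (InnerProductSpace.rankOne ℂ (sumTensor ψ) (sumTensor ψ)).toLinearMap) T := by
  intro ι f i j
  rw [hT]
  refine (f.hasSum_inner_mul_inner (ψ j) (X (ψ i))).congr_fun fun n => ?_
  rw [LinearMap.comp_apply, ContinuousLinearMap.coe_coe, InnerProductSpace.rankOne_apply,
    map_smul]
  refine (inner_smul_right (𝕜 := ℂ) (E := EuclideanSpace ℂ (Fin m) ⊗[ℂ] H) _ _ _).trans ?_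
  rw [lTensor_sumTensor, inner_single_tmul_sumTensor, inner_sumTensor_single_tmul]

/-! ### The GNS construction -/

section letterProjection

variable {SA SB GA GB : Type*} {m : ℕ} {H : Type*} [NormedAddCommGroup H] [InnerProductSpace ℂ H]
  [CompleteSpace H] {v : Fin m × List (Letter SA SB GA GB) → H}

/-- The orthogonal projection representing a letter. -/
def letterProjection (v : Fin m × List (Letter SA SB GA GB) → H) (σ : Letter SA SB GA GB) :
    H →L[ℂ] H :=
  spanProjection (v ∘ fun p : Fin m × List (Letter SA SB GA GB) => (p.1, σ :: p.2))

theorem isPositive_letterProjection (σ : Letter SA SB GA GB) :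
    (letterProjection v σ).IsPositive :=
  isPositive_spanProjection _

end letterProjection

section Construction

variable {SA SB GA GB : Type*} [Fintype GA] [Fintype GB] {m : ℕ}
  {φ : Fin m → Fin m → List (Letter SA SB GA GB) → ℂ}
  {H : Type} [NormedAddCommGroup H] [InnerProductSpace ℂ H] [CompleteSpace H]
  {v : Fin m × List (Letter SA SB GA GB) → H}

theorem letterProjection_apply (hφ : IsMomentFunctional φ)
    (hv : ∀ p q, ⟪v p, v q⟫_ℂ = φ q.1 p.1 (q.2.reverse ++ p.2)) (σ : Letter SA SB GA GB)
    (i : Fin m) (s : List (Letter SA SB GA GB)) :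
    letterProjection v σ (v (i, s)) = v (i, σ :: s) := by
  refine spanProjection_apply (v := v) (g := fun p => (p.1, σ :: p.2)) (fun p q => ?_)
    (fun p q => ?_) (i, s)
  · rw [hv, hv]
    simp
  · rw [hv, hv]
    refine hφ.congr _ _ _ _ (.symm _ _ ?_)
    have := Relation.EqvGen.rel _ _ (WordRule.double q.2.reverse p.2 σ)
    simpa [WordEquiv] using this

/-- Operator identities are tested on the total family v, where they become relations between
moments. Orthogonality of distinct answers is not needed: a strategy only asks for positive
operators summing to one. -/
theorem IsMomentFunctional.isCommutingMeasurementAssemblage_of_gram (hφ : IsMomentFunctional φ)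
    (hv : ∀ p q, ⟪v p, v q⟫_ℂ = φ q.1 p.1 (q.2.reverse ++ p.2))
    (hd : (Submodule.span ℂ (Set.range v)).topologicalClosure = ⊤)
    [TopologicalSpace.SeparableSpace H]
    {K : GA → GB → SA → SB → Matrix (Fin m) (Fin m) ℂ}
    (hK : ∀ a b x y i j, K a b x y i j = φ i j [Sum.inl (x, a), Sum.inr (y, b)]) :
    IsCommutingMeasurementAssemblage K := by
  have hP := letterProjection_apply hφ hv
  let ψ : Fin m → H := fun i => v (i, [])
  have hψ : ⟪sumTensor ψ, sumTensor ψ⟫_ℂ = 1 := by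
    rw [inner_sumTensor, ← hφ.normalized]
    refine Finset.sum_congr rfl fun i _ => ?_
    rw [hv]
    simp
  have hswap : ∀ i j s t (σ : SA × GA) (τ : SB × GB),
      φ i j (s ++ [Sum.inl σ, Sum.inr τ] ++ t) = φ i j (s ++ [Sum.inr τ, Sum.inl σ] ++ t) :=
    fun i j s t σ τ => hφ.congr _ _ _ _ (.rel _ _ (.swap s t σ τ))
  refine ⟨H, inferInstance, inferInstance, inferInstance, inferInstance,
    { state := InnerProductSpace.rankOne ℂ (sumTensor ψ) (sumTensor ψ)
      A := fun x a => letterProjection v (Sum.inl (x, a))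
      B := fun y b => letterProjection v (Sum.inr (y, b))
      state_density := isDensityOperator_rankOne hψ
      A_pos := fun x a => isPositive_letterProjection _
      B_pos := fun y b => isPositive_letterProjection _
      A_sum := ?_
      B_sum := ?_
      comm := ?_ }, ?_⟩
  · intro x
    refine ContinuousLinearMap.ext_of_dense_span hd fun p => eq_of_inner_dense_span hd fun q => ?_
    rw [FunLike.coe_sum, Finset.sum_apply, sum_inner, one_apply_eq_self, hv,
      ← hφ.sum_left _ _ _ _ x]
    refine Finset.sum_congr rfl fun a _ => ?_
    rw [hP, hv]
    simp
  · intro y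
    refine ContinuousLinearMap.ext_of_dense_span hd fun p => eq_of_inner_dense_span hd fun q => ?_
    rw [FunLike.coe_sum, Finset.sum_apply, sum_inner, one_apply_eq_self, hv,
      ← hφ.sum_right _ _ _ _ y]
    refine Finset.sum_congr rfl fun b _ => ?_
    rw [hP, hv]
    simp
  · intro x a y b
    refine ContinuousLinearMap.ext_of_dense_span hd fun p => eq_of_inner_dense_span hd fun q => ?_
    rw [mul_apply_eq_comp, mul_apply_eq_comp, hP, hP, hP, hP, hv, hv]
    simpa using hswap q.1 p.1 q.2.reverse p.2 (x, a) (y, b)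
  · intro a b x y
    refine hasPartialTrace_rankOne _ ψ fun i j => ?_
    rw [hK, ContinuousLinearMap.coe_coe, mul_apply_eq_comp, hP, hP, hv]
    -- The Gram convention reverses the word; the swap rule restores its order.
    simpa using hswap i j [] [] (x, a) (y, b)

end Construction

theorem IsMomentFunctional.isCommutingMeasurementAssemblage {SA SB GA GB : Type*} [Finite SA]
    [Finite SB] [Fintype GA] [Fintype GB] {m : ℕ}
    {φ : Fin m → Fin m → List (Letter SA SB GA GB) → ℂ} (hφ : IsMomentFunctional φ)
    {K : GA → GB → SA → SB → Matrix (Fin m) (Fin m) ℂ}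
    (hK : ∀ a b x y i j, K a b x y i j = φ i j [Sum.inl (x, a), Sum.inr (y, b)]) :
    IsCommutingMeasurementAssemblage K := by
  -- The alphabet may live in any universe while H must lie in `Type`; the countable index set has a
  -- small copy.
  let e : Fin m × List (Letter SA SB GA GB) ≃ Shrink.{0} (Fin m × List (Letter SA SB GA GB)) :=
    equivShrink _
  obtain ⟨H, _, _, _, v, hv, hd⟩ := (hφ.posSemidef.transpose.submatrix e.symm).exists_gram
  have : Countable (Shrink.{0} (Fin m × List (Letter SA SB GA GB))) := e.symm.injective.countable
  have := separableSpace_of_dense_span v hd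
  refine hφ.isCommutingMeasurementAssemblage_of_gram (v := v ∘ e) (fun p q => ?_) ?_ hK
  · simp [hv]
  · rwa [e.surjective.range_comp]

/-! ### Naimark dilation by matrices over a ring -/

section Naimark

variable {R G : Type*} [Ring R] [DecidableEq G]

/-- The self-adjoint unitary exchanging the first coordinate with the isometry whose entries
are `r a`. -/
def naimarkUnitary (r : G → R) : Matrix (Unit ⊕ G) (Unit ⊕ G) R :=
  Matrix.fromBlocks 0 (Matrix.of fun _ a => r a) (Matrix.of fun a _ => r a)
    (1 - Matrix.of fun a b => r a * r b)

/-- The coordinate projection for the outcome `a`; the first coordinate is assigned to `a₀`. -/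
def outcomeProjection (R : Type*) [Ring R] (a₀ a : G) : Matrix (Unit ⊕ G) (Unit ⊕ G) R :=
  Matrix.diagonal fun o => if Sum.elim (fun _ => a₀) id o = a then 1 else 0

theorem star_naimarkUnitary [StarRing R] {r : G → R} (hr : ∀ a, IsSelfAdjoint (r a)) :
    star (naimarkUnitary r) = naimarkUnitary r := by
  ext o o'
  rcases o with o | a <;> rcases o' with o' | b <;>
    simp [naimarkUnitary, (hr _).star_eq, Matrix.one_apply, eq_comm,
      apply_ite]

theorem star_outcomeProjection [StarRing R] (a₀ a : G) :
    star (outcomeProjection R a₀ a) = outcomeProjection R a₀ a := by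
  rw [outcomeProjection, Matrix.star_eq_conjTranspose, Matrix.diagonal_conjTranspose]
  congr 1
  ext o
  simp only [Pi.star_apply]
  split_ifs <;> simp

variable [Fintype G]

/-- Naimark's projective dilation of the measurement with operators `r a * r a`. -/
def naimarkProjection (r : G → R) (a₀ a : G) : Matrix (Unit ⊕ G) (Unit ⊕ G) R :=
  naimarkUnitary r * outcomeProjection R a₀ a * naimarkUnitary r

/-- With V the column of the r a, the hypothesis says V*V = 1 (V* denoting the row of the r a), and
the matrix with blocks 0, V*, V, 1 - VV* squares to 1. -/
theorem naimarkUnitary_mul_self {r : G → R} (hr : ∑ a, r a * r a = 1) :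
    naimarkUnitary r * naimarkUnitary r = 1 := by
  have h1 : (Matrix.of fun (_ : Unit) a => r a) * (Matrix.of fun a (_ : Unit) => r a) = 1 := by
    ext
    simp [Matrix.mul_apply, hr]
  have h2 : (Matrix.of fun a b => r a * r b) =
      (Matrix.of fun a (_ : Unit) => r a) * (Matrix.of fun (_ : Unit) a => r a) := by
    ext
    simp [Matrix.mul_apply]
  rw [naimarkUnitary, h2, Matrix.fromBlocks_multiply, ← Matrix.fromBlocks_one]
  congr 1
  · rw [h1, zero_mul, zero_add]
  · rw [Matrix.zero_mul, zero_add, Matrix.mul_sub, ← Matrix.mul_assoc, h1, Matrix.mul_one, Matrix.one_mul,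
      sub_self]
  · rw [Matrix.mul_zero, zero_add, Matrix.sub_mul, Matrix.mul_assoc, h1, Matrix.mul_one, Matrix.one_mul,
      sub_self]
  · have h3 : ((Matrix.of fun a (_ : Unit) => r a) * (Matrix.of fun (_ : Unit) a => r a)) *
        ((Matrix.of fun a (_ : Unit) => r a) * (Matrix.of fun (_ : Unit) a => r a)) =
        (Matrix.of fun a (_ : Unit) => r a) * (Matrix.of fun (_ : Unit) a => r a) := by
      rw [Matrix.mul_assoc, ← Matrix.mul_assoc (Matrix.of fun (_ : Unit) a => r a), h1,
        Matrix.one_mul]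
    rw [mul_sub, sub_mul, sub_mul, h3]
    simp

theorem outcomeProjection_mul (a₀ a b : G) :
    outcomeProjection R a₀ a * outcomeProjection R a₀ b =
      if a = b then outcomeProjection R a₀ a else 0 := by
  rw [outcomeProjection, outcomeProjection, Matrix.diagonal_mul_diagonal]
  split_ifs with h
  · subst h
    congr 1
    ext o
    split_ifs <;> simp
  · rw [← Matrix.diagonal_zero]
    congr 1
    ext o
    by_cases h1 : Sum.elim (fun _ => a₀) id o = a
    · simp [h1, h]
    · simp [h1]

theorem sum_outcomeProjection (a₀ : G) : ∑ a, outcomeProjection R a₀ a = 1 := by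
  ext o o'
  by_cases h : o = o'
  · subst h
    simp [outcomeProjection, Matrix.sum_apply]
  · simp [outcomeProjection, Matrix.sum_apply, h]

theorem star_naimarkProjection [StarRing R] {r : G → R} (hr : ∀ a, IsSelfAdjoint (r a)) (a₀ a : G) :
    star (naimarkProjection r a₀ a) = naimarkProjection r a₀ a := by
  rw [naimarkProjection, star_mul, star_mul, star_naimarkUnitary hr, star_outcomeProjection,
    mul_assoc]

theorem naimarkProjection_mul {r : G → R} (hr : ∑ a, r a * r a = 1) (a₀ a b : G) :
    naimarkProjection r a₀ a * naimarkProjection r a₀ b =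
      if a = b then naimarkProjection r a₀ a else 0 := by
  have : naimarkProjection r a₀ a * naimarkProjection r a₀ b =
      naimarkUnitary r * (outcomeProjection R a₀ a * (naimarkUnitary r * naimarkUnitary r) *
        outcomeProjection R a₀ b) * naimarkUnitary r := by
    simp only [naimarkProjection, mul_assoc]
  rw [this, naimarkUnitary_mul_self hr, mul_one, outcomeProjection_mul]
  split_ifs with h
  · rfl
  · simp

theorem sum_naimarkProjection {r : G → R} (hr : ∑ a, r a * r a = 1) (a₀ : G) :
    ∑ a, naimarkProjection r a₀ a = 1 := by
  simp only [naimarkProjection]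
  rw [← Finset.sum_mul, ← Finset.mul_sum, sum_outcomeProjection, mul_one,
    naimarkUnitary_mul_self hr]

/-- The corner entry of the unitary is 0, so the arbitrary choice of a₀ contributes nothing. -/
theorem naimarkProjection_inl_inl (r : G → R) (a₀ a : G) :
    naimarkProjection r a₀ a (.inl ()) (.inl ()) = r a * r a := by
  rw [naimarkProjection, outcomeProjection, Matrix.mul_apply]
  simp only [Matrix.mul_diagonal, naimarkUnitary, Fintype.sum_sum_type]
  rw [Finset.sum_eq_single_of_mem a (Finset.mem_univ a)] <;> simp +contextual

/-- The entries of the dilation are polynomials in the r a. This is what lets the other player's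
operators survive the dilation. -/
theorem commute_naimarkProjection_diagonal {r : G → R} {c : R} (hc : ∀ a, Commute (r a) c)
    (a₀ a : G) : Commute (naimarkProjection r a₀ a) (Matrix.diagonal fun _ => c) := by
  have hU : Commute (naimarkUnitary r) (Matrix.diagonal fun _ => c) := by
    ext o o'
    rw [Matrix.mul_diagonal, Matrix.diagonal_mul]
    rcases o with o | a <;> rcases o' with o' | b
    · simp [naimarkUnitary]
    · exact hc b
    · exact hc a
    · have : Commute (if a = b then 1 else 0 : R) c := by split_ifs <;> simp
      exact (this.sub_left ((hc a).mul_left (hc b)) : _)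
  have hq : Commute (outcomeProjection R a₀ a) (Matrix.diagonal fun _ => c) := by
    rw [outcomeProjection, Commute, SemiconjBy, Matrix.diagonal_mul_diagonal,
      Matrix.diagonal_mul_diagonal]
    congr 1
    ext o
    split_ifs <;> simp
  exact (hU.mul_left hq).mul_left hU

end Naimark

/-! ### Projective representations of letters and words -/

/-- Letters are represented by projections in a star ring, those of each question forming a
projective measurement, and the measurements of the two players commuting. -/
structure IsLetterRepresentation {SA SB GA GB 𝒜 : Type*} [Fintype GA] [Fintype GB] [Ring 𝒜]
    [StarRing 𝒜] (p : Letter SA SB GA GB → 𝒜) : Prop where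
  star_eq : ∀ σ, star (p σ) = p σ
  mul_self : ∀ σ, p σ * p σ = p σ
  orth_left : ∀ x a a', a ≠ a' → p (Sum.inl (x, a)) * p (Sum.inl (x, a')) = 0
  orth_right : ∀ y b b', b ≠ b' → p (Sum.inr (y, b)) * p (Sum.inr (y, b')) = 0
  sum_left : ∀ x, ∑ a, p (Sum.inl (x, a)) = 1
  sum_right : ∀ y, ∑ b, p (Sum.inr (y, b)) = 1
  comm : ∀ x a y b, Commute (p (Sum.inl (x, a))) (p (Sum.inr (y, b)))

/-- Matrices over `R` with one additional index set for each player. -/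
abbrev DoubleMatrix (GA GB R : Type*) :=
  Matrix (Unit ⊕ GB) (Unit ⊕ GB) (Matrix (Unit ⊕ GA) (Unit ⊕ GA) R)

/-- Alice is dilated over R. Bob's operators are placed diagonally, commute with her dilation, and
are dilated over the enlarged ring, where her projections are placed diagonally in turn. -/
theorem exists_isLetterRepresentation {SA SB GA GB R : Type*} [Fintype GA] [DecidableEq GA]
    [Nonempty GA] [Fintype GB] [DecidableEq GB] [Nonempty GB] [Ring R] [StarRing R]
    {r : SA → GA → R} {s : SB → GB → R}
    (hr : ∀ x a, IsSelfAdjoint (r x a)) (hs : ∀ y b, IsSelfAdjoint (s y b))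
    (hr1 : ∀ x, ∑ a, r x a * r x a = 1) (hs1 : ∀ y, ∑ b, s y b * s y b = 1)
    (hrs : ∀ x a y b, Commute (r x a) (s y b)) :
    ∃ p : Letter SA SB GA GB → DoubleMatrix GA GB R, IsLetterRepresentation p ∧
      ∀ x a y b, (p (Sum.inl (x, a)) * p (Sum.inr (y, b))) (.inl ()) (.inl ()) (.inl ()) (.inl ()) =
        r x a * r x a * (s y b * s y b) := by
  let a₀ : GA := Classical.arbitrary GA
  let b₀ : GB := Classical.arbitrary GB
  let P : SA → GA → Matrix (Unit ⊕ GA) (Unit ⊕ GA) R := fun x a => naimarkProjection (r x) a₀ a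
  let S : SB → GB → Matrix (Unit ⊕ GA) (Unit ⊕ GA) R := fun y b => Matrix.diagonal fun _ => s y b
  have hS : ∀ y b, IsSelfAdjoint (S y b) := fun y b => by
    rw [IsSelfAdjoint, Matrix.star_eq_conjTranspose, Matrix.diagonal_conjTranspose]
    congr 1
    ext o
    exact (hs y b).star_eq
  have hS2 : ∀ y b, S y b * S y b = Matrix.diagonal fun _ => s y b * s y b := fun y b =>
    Matrix.diagonal_mul_diagonal _ _
  have hS1 : ∀ y, ∑ b, S y b * S y b = 1 := fun y => by
    simp_rw [hS2]
    ext o o'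
    by_cases h : o = o'
    · subst h
      simp [Matrix.sum_apply, hs1]
    · simp [Matrix.sum_apply, h]
  have hPS : ∀ x a y b, Commute (P x a) (S y b) := fun x a y b =>
    commute_naimarkProjection_diagonal (fun a => hrs x a y b) a₀ a
  refine ⟨Sum.elim (fun z => Matrix.diagonal fun _ => P z.1 z.2)
    (fun z => naimarkProjection (S z.1) b₀ z.2), ⟨?_, ?_, ?_, ?_, ?_, ?_, ?_⟩, ?_⟩
  · rintro (⟨x, a⟩ | ⟨y, b⟩)
    · simp only [Sum.elim_inl]
      rw [Matrix.star_eq_conjTranspose, Matrix.diagonal_conjTranspose]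
      congr 1
      ext1 o
      exact star_naimarkProjection (hr x) a₀ a
    · exact star_naimarkProjection (hS y) b₀ b
  · rintro (⟨x, a⟩ | ⟨y, b⟩)
    · simp only [Sum.elim_inl, Matrix.diagonal_mul_diagonal, P]
      rw [naimarkProjection_mul (hr1 x), if_pos rfl]
    · simp only [Sum.elim_inr]
      rw [naimarkProjection_mul (hS1 y), if_pos rfl]
  · intro x a a' h
    simp only [Sum.elim_inl, Matrix.diagonal_mul_diagonal, P]
    rw [naimarkProjection_mul (hr1 x), if_neg h]
    exact Matrix.diagonal_zero
  · intro y b b' h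
    simp only [Sum.elim_inr]
    rw [naimarkProjection_mul (hS1 y), if_neg h]
  · intro x
    ext1 o o'
    have := sum_naimarkProjection (hr1 x) a₀
    by_cases h : o = o'
    · subst h
      simp [Matrix.sum_apply, P, this]
    · simp [Matrix.sum_apply, h]
  · intro y
    exact sum_naimarkProjection (hS1 y) b₀
  · intro x a y b
    exact (commute_naimarkProjection_diagonal (fun b => (hPS x a y b).symm) b₀ b).symm
  · intro x a y b
    simp only [Sum.elim_inl, Sum.elim_inr, Matrix.diagonal_mul]
    rw [naimarkProjection_inl_inl, hS2, Matrix.mul_diagonal]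
    exact congrArg (· * _) (naimarkProjection_inl_inl (r x) a₀ a)

/-- The product of the operators of the letters of a word, in reverse order. -/
def wordOperator {SA SB GA GB 𝒜 : Type*} [Ring 𝒜] (p : Letter SA SB GA GB → 𝒜)
    (w : List (Letter SA SB GA GB)) : 𝒜 :=
  (w.reverse.map p).prod

theorem wordOperator_append {SA SB GA GB 𝒜 : Type*} [Ring 𝒜] (p : Letter SA SB GA GB → 𝒜)
    (s t : List (Letter SA SB GA GB)) :
    wordOperator p (s ++ t) = wordOperator p t * wordOperator p s := by
  simp [wordOperator]

section WordOperator

variable {SA SB GA GB 𝒜 : Type*} [Fintype GA] [Fintype GB] [Ring 𝒜] [StarRing 𝒜]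
  {p : Letter SA SB GA GB → 𝒜}

theorem IsLetterRepresentation.star_prod (hp : IsLetterRepresentation p)
    (w : List (Letter SA SB GA GB)) : star (w.map p).prod = wordOperator p w := by
  induction w with
  | nil => simp [wordOperator]
  | cons σ w ih => simpa [wordOperator, hp.star_eq] using congrArg (· * p σ) ih

theorem IsLetterRepresentation.wordOperator_congr (hp : IsLetterRepresentation p)
    {s t : List (Letter SA SB GA GB)} (h : WordEquiv s t) :
    wordOperator p s = wordOperator p t := by
  induction h with
  | rel _ _ h =>
    cases h with
    | double s t σ =>
      simp only [wordOperator_append]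
      simp [wordOperator, hp.mul_self]
    | swap s t σ τ =>
      simp only [wordOperator_append]
      simp [wordOperator, (hp.comm σ.1 σ.2 τ.1 τ.2).eq]
  | refl _ => rfl
  | symm _ _ _ ih => exact ih.symm
  | trans _ _ _ _ _ ih₁ ih₂ => exact ih₁.trans ih₂

/-- Admissibility uses only additivity of f; positivity enters separately. -/
theorem IsLetterRepresentation.isAdmissibleFunction (hp : IsLetterRepresentation p) (f : 𝒜 →+ ℂ)
    (n : ℕ) :
    IsAdmissibleFunction fun w : WordLE SA SB GA GB n => f (wordOperator p w.1) where
  sum_left s t _ x := by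
    simp only [wordOperator_append]
    rw [← map_sum, ← Finset.mul_sum, ← Finset.sum_mul]
    simp [wordOperator, hp.sum_left]
  sum_right s t _ y := by
    simp only [wordOperator_append]
    rw [← map_sum, ← Finset.mul_sum, ← Finset.sum_mul]
    simp [wordOperator, hp.sum_right]
  orth_left s t _ x a a' h := by
    simp only [wordOperator_append]
    simp [wordOperator, hp.orth_left x a' a h.symm]
  orth_right s t _ y b b' h := by
    simp only [wordOperator_append]
    simp [wordOperator, hp.orth_right y b' b h.symm]
  congr s t h := by rw [hp.wordOperator_congr h]

theorem IsLetterRepresentation.isPseudoCommutingMeasurementAssemblage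
    (hp : IsLetterRepresentation p) {m : ℕ} (f : Fin m → Fin m → 𝒜 →+ ℂ)
    (hf1 : ∑ i, f i i 1 = 1)
    (hf : (Matrix.of fun u v : Fin m × List (Letter SA SB GA GB) =>
      f u.1 v.1 (star (v.2.map p).prod * (u.2.map p).prod)).PosSemidef)
    {K : GA → GB → SA → SB → Matrix (Fin m) (Fin m) ℂ}
    (hK : ∀ a b x y i j, K a b x y i j = f i j (p (Sum.inl (x, a)) * p (Sum.inr (y, b))))
    (k : ℕ) (hk : 1 ≤ k) : IsPseudoCommutingMeasurementAssemblage k hk K := by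
  refine ⟨Matrix.of fun u v => f u.1 v.1 (wordOperator p (u.2.1.reverse ++ v.2.1)), ⟨?_, ?_, ?_⟩,
    ?_⟩
  · intro i j
    exact ⟨_, hp.isAdmissibleFunction (f i j) (2 * k), fun s t => rfl⟩
  · simpa [wordOperator] using hf1
  · convert! hf.submatrix fun u : Fin m × WordLE SA SB GA GB k => (u.1, u.2.1) using 1
    ext u v
    simp only [Matrix.of_apply, Matrix.submatrix_apply, hp.star_prod, wordOperator_append]
    simp [wordOperator]
  · intro a b x y
    ext i j
    -- Commutation undoes the reversal built into `wordOperator`.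
    rw [hK, momentEntry, (hp.comm x a y b).eq]
    simp [wordOperator]

end WordOperator

/-! ### Density operators as sums of vector states -/

section StateFunctional

variable {m : ℕ} {κ H : Type*} [NormedAddCommGroup H] [InnerProductSpace ℂ H]

theorem summable_norm_sq_of_hasSum {ψ : κ → Fin m → H} {c : ℂ}
    (hψ : HasSum (fun k => ∑ i, ⟪ψ k i, ψ k i⟫_ℂ) c) (i : Fin m) :
    Summable fun k => ‖ψ k i‖ ^ 2 := by
  have h1 : Summable fun k => ∑ i, ‖ψ k i‖ ^ 2 := by
    refine (Complex.hasSum_re hψ).summable.congr fun k => ?_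
    simp only [Complex.re_sum]
    refine Finset.sum_congr rfl fun i _ => ?_
    exact inner_self_eq_norm_sq (𝕜 := ℂ) (ψ k i)
  exact h1.of_nonneg_of_le (fun k => sq_nonneg _) fun k =>
    Finset.single_le_sum (f := fun i => ‖ψ k i‖ ^ 2) (fun j _ => sq_nonneg _) (Finset.mem_univ i)

theorem summable_inner_apply {ψ χ : κ → H} (hψ : Summable fun k => ‖ψ k‖ ^ 2)
    (hχ : Summable fun k => ‖χ k‖ ^ 2) (X : H →L[ℂ] H) :
    Summable fun k => ⟪ψ k, X (χ k)⟫_ℂ := by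
  refine Summable.of_norm_bounded ((hψ.add hχ).mul_left ‖X‖) fun k => ?_
  calc ‖⟪ψ k, X (χ k)⟫_ℂ‖ ≤ ‖ψ k‖ * (‖X‖ * ‖χ k‖) :=
        (norm_inner_le_norm _ _).trans (by gcongr; exact X.le_opNorm _)
    _ = ‖X‖ * (‖ψ k‖ * ‖χ k‖) := by ring
    _ ≤ ‖X‖ * (‖ψ k‖ ^ 2 + ‖χ k‖ ^ 2) := by
        gcongr
        nlinarith [sq_nonneg (‖ψ k‖ - ‖χ k‖), sq_nonneg ‖ψ k‖, sq_nonneg ‖χ k‖]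

/-- The functional `X ↦ ∑ k, ⟨ψ_k, X χ_k⟩`. -/
def vectorFunctional (ψ χ : κ → H) (hψ : Summable fun k => ‖ψ k‖ ^ 2)
    (hχ : Summable fun k => ‖χ k‖ ^ 2) : (H →L[ℂ] H) →+ ℂ where
  toFun X := ∑' k, ⟪ψ k, X (χ k)⟫_ℂ
  map_zero' := by simp
  map_add' X Y := by
    simp_rw [add_apply, inner_add_right]
    exact (summable_inner_apply hψ hχ X).tsum_add (summable_inner_apply hψ hχ Y)

/-- The trace over `H` of `X` times an operator on `H` can be computed along any orthonormal
basis. -/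
theorem HilbertBasis.hasSum_inner_swap {ι : Type*} (f : HilbertBasis ι ℂ H) {ψ χ : κ → H}
    (hψ : Summable fun k => ‖ψ k‖ ^ 2) (hχ : Summable fun k => ‖χ k‖ ^ 2) {a : ι → ℂ} {z : ℂ}
    (ha : ∀ n, HasSum (fun k => ⟪ψ k, f n⟫_ℂ * ⟪f n, χ k⟫_ℂ) (a n)) (hz : HasSum a z) :
    HasSum (fun k => ⟪ψ k, χ k⟫_ℂ) z := by
  have hsq : ∀ x : H, HasSum (fun n => ‖⟪f n, x⟫_ℂ‖ ^ 2) (‖x‖ ^ 2) := fun x => by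
    have := Complex.hasSum_re (f.hasSum_inner_mul_inner x x)
    have h2 : (⟪x, x⟫_ℂ).re = ‖x‖ ^ 2 := inner_self_eq_norm_sq (𝕜 := ℂ) x
    rw [h2] at this
    refine this.congr_fun fun n => ?_
    rw [← inner_conj_symm x, ← Complex.normSq_eq_conj_mul_self, Complex.ofReal_re,
      Complex.normSq_eq_norm_sq]
  have hprod : ∀ ψ : κ → H, (Summable fun k => ‖ψ k‖ ^ 2) →
      Summable fun q : κ × ι => ‖⟪f q.2, ψ q.1⟫_ℂ‖ ^ 2 := fun ψ hψ => by
    refine (summable_prod_of_nonneg fun q => sq_nonneg _).mpr ⟨fun k => (hsq (ψ k)).summable, ?_⟩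
    simpa only [(hsq _).tsum_eq] using hψ
  -- Absolute summability over pairs, from |ab| ≤ |a|² + |b|² and Parseval, permits exchanging the
  -- two sums.
  have hs : Summable fun q : κ × ι => ⟪ψ q.1, f q.2⟫_ℂ * ⟪f q.2, χ q.1⟫_ℂ := by
    refine Summable.of_norm_bounded ((hprod ψ hψ).add (hprod χ hχ)) fun q => ?_
    rw [norm_mul, norm_inner_symm (ψ q.1)]
    nlinarith [sq_nonneg (‖⟪f q.2, ψ q.1⟫_ℂ‖ - ‖⟪f q.2, χ q.1⟫_ℂ‖),
      sq_nonneg ‖⟪f q.2, ψ q.1⟫_ℂ‖, sq_nonneg ‖⟪f q.2, χ q.1⟫_ℂ‖]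
  have h1 : HasSum (fun k => ⟪ψ k, χ k⟫_ℂ)
      (∑' q : κ × ι, ⟪ψ q.1, f q.2⟫_ℂ * ⟪f q.2, χ q.1⟫_ℂ) :=
    hs.hasSum.prod_fiberwise fun k => f.hasSum_inner_mul_inner (ψ k) (χ k)
  have h2 : HasSum a (∑' q : κ × ι, ⟪ψ q.1, f q.2⟫_ℂ * ⟪f q.2, χ q.1⟫_ℂ) :=
    ((Equiv.prodComm ι κ).hasSum_iff.mpr hs.hasSum).prod_fiberwise ha
  rwa [hz.unique h2]

end StateFunctional

section SumTensor

variable {m : ℕ} {H : Type*} [NormedAddCommGroup H] [InnerProductSpace ℂ H]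

theorem sumTensor_surjective : Function.Surjective (sumTensor (m := m) (H := H)) := by
  intro w
  induction w with
  | zero => exact ⟨0, by simp [sumTensor]⟩
  | add v w hv hw =>
    obtain ⟨ψ, rfl⟩ := hv
    obtain ⟨χ, rfl⟩ := hw
    exact ⟨ψ + χ, by simp [sumTensor, TensorProduct.tmul_add, Finset.sum_add_distrib]⟩
  | tmul x h =>
    refine ⟨fun i => x i • h, ?_⟩
    simp only [sumTensor, TensorProduct.tmul_smul, TensorProduct.smul_tmul']
    rw [← TensorProduct.sum_tmul]
    congr 1
    ext j
    simp [Finset.sum_apply, Pi.single_apply]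

/-- The identification of `H^m` with `ℂ^m ⊗ H`. -/
def sumTensorIsometry (m : ℕ) (H : Type*) [NormedAddCommGroup H] [InnerProductSpace ℂ H] :
    PiLp 2 (fun _ : Fin m => H) →ₗᵢ[ℂ] EuclideanSpace ℂ (Fin m) ⊗[ℂ] H :=
  LinearMap.isometryOfInner
    { toFun := fun ψ => sumTensor fun i => ψ i
      map_add' := fun ψ χ => by
        simp [sumTensor, TensorProduct.tmul_add, Finset.sum_add_distrib]
      map_smul' := fun c ψ => by simp [sumTensor, Finset.smul_sum] }
    fun ψ χ => (inner_sumTensor _ _).trans (PiLp.inner_apply _ _).symm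

/-- The space is an isometric image of H^m. Completeness is required for the square root of the
state. -/
theorem completeSpace_euclideanSpace_tensorProduct [CompleteSpace H] :
    CompleteSpace (EuclideanSpace ℂ (Fin m) ⊗[ℂ] H) := by
  have hs : Function.Surjective (sumTensorIsometry m H) := fun w => by
    obtain ⟨ψ, rfl⟩ := sumTensor_surjective w
    exact ⟨WithLp.toLp 2 ψ, rfl⟩
  have h : IsComplete (Set.range (sumTensorIsometry m H)) := by
    rw [← Set.image_univ]
    exact (LinearIsometry.isComplete_image_iff _).mpr isComplete_univ
  rw [hs.range_eq] at h
  exact completeSpace_iff_isComplete_univ.mpr h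

end SumTensor

theorem ContinuousLinearMap.IsPositive.exists_sqrt {E : Type*} [NormedAddCommGroup E]
    [InnerProductSpace ℂ E] [CompleteSpace E] {T : E →L[ℂ] E} (hT : T.IsPositive) :
    ∃ Q : E →L[ℂ] E, (∀ v w, ⟪Q v, w⟫_ℂ = ⟪v, Q w⟫_ℂ) ∧ ∀ v, T v = Q (Q v) := by
  have hT0 : 0 ≤ T := (ContinuousLinearMap.nonneg_iff_isPositive T).mpr hT
  refine ⟨CFC.sqrt T, ((ContinuousLinearMap.nonneg_iff_isPositive _).mp
    (CFC.sqrt_nonneg T)).inner_left_eq_inner_right, fun v => ?_⟩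
  rw [← mul_apply_eq_comp, CFC.sqrt_mul_sqrt_self T hT0]

/-- Positive semidefinite operators of finite trace on `ℂ^m ⊗ H` are sums of rank one operators
`|ψ_k⟩⟨ψ_k|`; their partial traces are computed accordingly. -/
theorem IsDensityOperator.exists_vectors {m : ℕ} {H : Type} [NormedAddCommGroup H]
    [InnerProductSpace ℂ H] [CompleteSpace H]
    {ρ : (EuclideanSpace ℂ (Fin m) ⊗[ℂ] H) →L[ℂ] (EuclideanSpace ℂ (Fin m) ⊗[ℂ] H)}
    (hρ : IsDensityOperator ρ) :
    ∃ (κ : Type) (ψ : κ → Fin m → H), HasSum (fun k => ∑ i, ⟪ψ k i, ψ k i⟫_ℂ) 1 ∧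
      ∀ (X : H →L[ℂ] H) (T : Matrix (Fin m) (Fin m) ℂ),
        HasPartialTrace (X.toLinearMap.lTensor (EuclideanSpace ℂ (Fin m)) ∘ₗ ρ.toLinearMap) T →
        ∀ i j, HasSum (fun k => ⟪ψ k j, X (ψ k i)⟫_ℂ) (T i j) := by
  have := completeSpace_euclideanSpace_tensorProduct (m := m) (H := H)
  obtain ⟨Q, hQ, hρQ⟩ := hρ.1.exists_sqrt
  obtain ⟨κ, g, -⟩ := exists_hilbertBasis ℂ (EuclideanSpace ℂ (Fin m) ⊗[ℂ] H)
  -- With ρ = Q², ρ is formally the sum of |Q g_k⟩⟨Q g_k|; the ψ_k i are the components of Q g_k.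
  choose ψ hψ using fun k : κ => sumTensor_surjective (Q (g k))
  have hψ1 : HasSum (fun k => ∑ i, ⟪ψ k i, ψ k i⟫_ℂ) 1 := by
    refine (hρ.2 κ g).congr_fun fun k => ?_
    rw [← inner_sumTensor, hψ, hρQ, hQ]
  refine ⟨κ, ψ, hψ1, fun X T hT i j => ?_⟩
  obtain ⟨ι, f, -⟩ := exists_hilbertBasis ℂ H
  have hsum := summable_norm_sq_of_hasSum hψ1
  refine f.hasSum_inner_swap (hsum j) ?_ (fun n => ?_) (hT ι f i j)
  · refine ((hsum i).mul_left (‖X‖ ^ 2)).of_nonneg_of_le (fun k => sq_nonneg _) fun k => ?_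
    rw [← mul_pow]
    exact pow_le_pow_left₀ (norm_nonneg _) (X.le_opNorm _) 2
  · have hX : ∀ w, ⟪EuclideanSpace.single i (1 : ℂ) ⊗ₜ[ℂ] f n,
        X.toLinearMap.lTensor (EuclideanSpace ℂ (Fin m)) w⟫_ℂ =
        ⟪EuclideanSpace.single i (1 : ℂ) ⊗ₜ[ℂ] X.adjoint (f n), w⟫_ℂ := fun w => by
      obtain ⟨χ, rfl⟩ := sumTensor_surjective w
      rw [lTensor_sumTensor, inner_single_tmul_sumTensor, inner_single_tmul_sumTensor,
        ContinuousLinearMap.adjoint_inner_left]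
      rfl
    -- The n-th diagonal term of the partial trace, expanded along the basis g.
    have h := g.hasSum_inner_mul_inner
      (Q (EuclideanSpace.single i (1 : ℂ) ⊗ₜ[ℂ] X.adjoint (f n)))
      (Q (EuclideanSpace.single j (1 : ℂ) ⊗ₜ[ℂ] f n))
    rw [hQ, ← hρQ, ← hX] at h
    refine h.congr_fun fun k => ?_
    rw [hQ, ← hQ (g k), ← hψ, inner_single_tmul_sumTensor, inner_sumTensor_single_tmul,
      ContinuousLinearMap.adjoint_inner_left, mul_comm]

/-! ### From strategies to admissible matrices -/

/-- The compression of a matrix to the first coordinates. -/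
def DoubleMatrix.corner (GA GB R : Type*) [Ring R] : DoubleMatrix GA GB R →+ R where
  toFun Z := Z (.inl ()) (.inl ()) (.inl ()) (.inl ())
  map_zero' := rfl
  map_add' _ _ := rfl

theorem DoubleMatrix.corner_one (GA GB R : Type*) [Ring R] [DecidableEq GA] [DecidableEq GB] :
    corner GA GB R 1 = 1 := by
  change (1 : DoubleMatrix GA GB R) (.inl ()) (.inl ()) (.inl ()) (.inl ()) = 1
  rw [Matrix.one_apply_eq, Matrix.one_apply_eq]

theorem DoubleMatrix.corner_star_mul {GA GB R : Type*} [Fintype GA] [Fintype GB] [Ring R]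
    [StarRing R] (Z W : DoubleMatrix GA GB R) :
    corner GA GB R (star Z * W) = ∑ l : (Unit ⊕ GB) × (Unit ⊕ GA),
      star (Z l.1 (.inl ()) l.2 (.inl ())) * W l.1 (.inl ()) l.2 (.inl ()) := by
  change (star Z * W) (.inl ()) (.inl ()) (.inl ()) (.inl ()) = _
  rw [Matrix.mul_apply, Matrix.sum_apply, Fintype.sum_prod_type]
  exact Finset.sum_congr rfl fun l _ => Matrix.mul_apply

theorem IsCommutingMeasurementAssemblage.isPseudoCommutingMeasurementAssemblage
    {SA SB GA GB : Type*} [Fintype GA] [Nonempty GA] [Fintype GB] [Nonempty GB] {m : ℕ}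
    {K : GA → GB → SA → SB → Matrix (Fin m) (Fin m) ℂ} (hK : IsCommutingMeasurementAssemblage K)
    (k : ℕ) (hk : 1 ≤ k) : IsPseudoCommutingMeasurementAssemblage k hk K := by
  classical
  obtain ⟨H, _, _, _, _, S, hS⟩ := hK
  obtain ⟨κ, ψ, hψ1, hψ⟩ := S.state_density.exists_vectors
  have hA : ∀ x a, 0 ≤ S.A x a := fun x a =>
    (ContinuousLinearMap.nonneg_iff_isPositive _).mpr (S.A_pos x a)
  have hB : ∀ y b, 0 ≤ S.B y b := fun y b =>
    (ContinuousLinearMap.nonneg_iff_isPositive _).mpr (S.B_pos y b)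
  have hAA : ∀ x a, CFC.sqrt (S.A x a) * CFC.sqrt (S.A x a) = S.A x a := fun x a =>
    CFC.sqrt_mul_sqrt_self _ (hA x a)
  have hBB : ∀ y b, CFC.sqrt (S.B y b) * CFC.sqrt (S.B y b) = S.B y b := fun y b =>
    CFC.sqrt_mul_sqrt_self _ (hB y b)
  obtain ⟨p, hp, hpc⟩ := exists_isLetterRepresentation
    (r := fun x a => CFC.sqrt (S.A x a)) (s := fun y b => CFC.sqrt (S.B y b))
    (fun x a => .of_nonneg (CFC.sqrt_nonneg _)) (fun y b => .of_nonneg (CFC.sqrt_nonneg _))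
    (fun x => by simp_rw [hAA, S.A_sum]) (fun y => by simp_rw [hBB, S.B_sum])
    -- Functional calculus preserves commutation, so the square roots commute.
    (fun x a y b => ((S.comm x a y b).cfcₙ_nnreal _).symm.cfcₙ_nnreal _ |>.symm)
  have hsum := summable_norm_sq_of_hasSum hψ1
  let c := DoubleMatrix.corner GA GB (H →L[ℂ] H)
  let F : Fin m → Fin m → (H →L[ℂ] H) →+ ℂ := fun i j =>
    vectorFunctional (fun k => ψ k j) (fun k => ψ k i) (hsum j) (hsum i)
  refine hp.isPseudoCommutingMeasurementAssemblage (fun i j => (F i j).comp c) ?_ ?_ ?_ k hk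
  · have h1 : ∀ i, (F i i).comp c 1 = ∑' k, ⟪ψ k i, ψ k i⟫_ℂ := fun i => by
      rw [AddMonoidHom.comp_apply, DoubleMatrix.corner_one]
      rfl
    simp_rw [h1]
    rw [← Summable.tsum_finsetSum fun i _ => by
      simpa using summable_inner_apply (hsum i) (hsum i) 1]
    exact hψ1.tsum_eq
  · let Y : List (Letter SA SB GA GB) → DoubleMatrix GA GB (H →L[ℂ] H) := fun w => (w.map p).prod
    -- These are the Gram vectors: the first column of the word's matrix applied to ψ_k, one vector
    -- for each row l. Finite sums over k converge entrywise to the moment matrix.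
    let y : κ → (Unit ⊕ GB) × (Unit ⊕ GA) → Fin m × List (Letter SA SB GA GB) → H :=
      fun k l u => Y u.2 l.1 (.inl ()) l.2 (.inl ()) (ψ k u.1)
    refine Matrix.PosSemidef.of_tendsto (l := (atTop : Filter (Finset κ)))
      (N := fun s => ∑ k ∈ s, ∑ l, (Matrix.of fun u v => ⟪y k l u, y k l v⟫_ℂ).transpose)
      (fun s => Matrix.posSemidef_sum _ fun k _ => Matrix.posSemidef_sum _ fun l _ =>
        (Matrix.posSemidef_of_inner (y k l) fun _ _ => rfl).transpose) fun u v => ?_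
    have h := (summable_inner_apply (hsum v.1) (hsum u.1) (c (star (Y v.2) * Y u.2))).hasSum
    refine h.congr fun s => ?_
    rw [Matrix.sum_apply]
    refine Finset.sum_congr rfl fun k _ => ?_
    beta_reduce
    rw [Matrix.sum_apply, DoubleMatrix.corner_star_mul, FunLike.coe_sum, Finset.sum_apply,
      inner_sum]
    refine Finset.sum_congr rfl fun l _ => ?_
    rw [mul_apply_eq_comp, ContinuousLinearMap.star_eq_adjoint,
      ContinuousLinearMap.adjoint_inner_right]
    rfl
  · intro a b x y i j
    have h : c (p (Sum.inl (x, a)) * p (Sum.inr (y, b))) = S.A x a * S.B y b := by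
      rw [← hAA, ← hBB]
      exact hpc x a y b
    rw [AddMonoidHom.comp_apply, h]
    exact ((hψ _ _ (hS a b x y) i j).tsum_eq).symm

end

theorem mainTheorem2 (SA SB GA GB : Type*) [Fintype SA] [Nonempty SA] [Fintype SB] [Nonempty SB]
    [Fintype GA] [Nonempty GA] [Fintype GB] [Nonempty GB] (m : ℕ) (hm : 1 ≤ m)
    (K : GA → GB → SA → SB → Matrix (Fin m) (Fin m) ℂ) :
    IsCommutingMeasurementAssemblage K ↔
      ∀ (k : ℕ) (hk : 1 ≤ k), IsPseudoCommutingMeasurementAssemblage k hk K := by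
  refine ⟨fun h k hk => h.isPseudoCommutingMeasurementAssemblage k hk, fun h => ?_⟩
  obtain ⟨φ, hφ, hK⟩ := exists_isMomentFunctional h
  exact hφ.isCommutingMeasurementAssemblage hK
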